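/- Let $G$ be a locally finite connected graph, with vertex set $V$ and edge set $E$. An assignment of resistances $R(e)\in(0,\infty)$, $e\in E$, defines the random walk on $V$ with transition probabilities $$p(v,w)=\frac{R(vw)^{-1}}{\sum_{z\sim v}R(vz)^{-1}}\qquad (w\sim v);$$ at an isolated vertex the walk stays put. The network $\{R(e)\}$ (the walk) is called transient if the walk started at any vertex has positive probability of never returning to that vertex. Simple random walk is the case $R\equiv 1$. The effective resistance from $v$ to infinity is the infimum of the energies $\sum_{e}F(e)^2R(e)$ over all unit flows $F$ from $v$ to infinity, that is, antisymmetric functions on the oriented edges with net outflow $1$ at $v$ and $0$ at every other vertex; it is $\infty$ if no such flow has finite energy. For a probability measure $\mu$ on $(0,\infty)$ let the resistances $R(e)$, $e\in E$, be i.i.d. with common law $\mu$. (i) If $\int x\,d\mu(x)<\infty$ and simple random walk on $G$ is transient, then almost surely the network $\{R(e)\}$ has finite effective resistance from every vertex to infinity, and almost surely the random walk that it defines is transient. (ii) The following two conditions on $G$ are equivalent: (a) for every probability measure $\mu$ on $(0,\infty)$, the network with i.i.d. resistances of law $\mu$ is almost surely transient; (b) there is a $p\in[0,1)$ such that, with positive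 probability, independent bond percolation on $G$ with parameter $p$ (each edge is open with probability $p$) has a cluster (a connected component of the graph of open edges) on which simple random walk is transient. -/

import Mathlib

open MeasureTheory ProbabilityTheory
open scoped ENNReal

noncomputable section

namespace RandomNetwork

variable {V : Type*}

/-- An assignment of a resistance in `(0, ∞)` to every edge of `H`. -/
abbrev Resistances (H : SimpleGraph V) : Type _ := H.edgeSet → Set.Ioi (0 : ℝ)

/-- All edges have resistance `1`; the corresponding walk is simple random walk. -/
def unitResistances (H : SimpleGraph V) : Resistances H := fun _ => ⟨1, Set.mem_Ioi.2 one_pos⟩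

open Classical in
/-- The conductance `R(vw)⁻¹` of a pair of adjacent vertices, and `0` for other pairs. -/
def conductance (H : SimpleGraph V) (R : Resistances H) (v w : V) : ℝ≥0∞ :=
  if h : H.Adj v w then ENNReal.ofReal (R ⟨s(v, w), h⟩ : ℝ)⁻¹ else 0

open Classical in
/-- The transition probabilities `p(v, w) = R(vw)⁻¹ / ∑_z R(vz)⁻¹` out of `v`. For a locally
finite graph the second case occurs only when `v` is isolated, and then the walk stays at `v`. -/
def stepLaw (H : SimpleGraph V) (R : Resistances H) (v : V) : PMF V :=
  if h : (∑' z, conductance H R v z) ≠ 0 ∧ (∑' z, conductance H R v z) ≠ ∞ then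
    PMF.normalize (conductance H R v) h.1 h.2
  else PMF.pure v

/-- A function on a discrete state space, seen as the transition kernel of a Markov chain whose
next state depends only on the last state of the past. -/
def markovKernel [MeasurableSpace V] [DiscreteMeasurableSpace V] (q : V → PMF V) (n : ℕ) :
    Kernel (Π _ : Finset.Iic n, V) V where
  toFun x := (q (x ⟨n, Finset.mem_Iic.2 le_rfl⟩)).toMeasure
  measurable' := (Measurable.of_discrete (f := fun v => (q v).toMeasure)).comp
    (measurable_pi_apply _)

instance [MeasurableSpace V] [DiscreteMeasurableSpace V] (q : V → PMF V) (n : ℕ) :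
    IsMarkovKernel (markovKernel q n) :=
  ⟨fun _ => PMF.toMeasure.isProbabilityMeasure _⟩

/-- The law, on the space of trajectories `ℕ → V`, of the time-homogeneous Markov chain with
transition probabilities `q` started at `v`. -/
def chainLaw [MeasurableSpace V] [DiscreteMeasurableSpace V] (q : V → PMF V) (v : V) :
    Measure (ℕ → V) :=
  Kernel.traj (X := fun _ => V) (markovKernel q) 0 (fun _ => v)

/-- The probability that the random walk on the network `(H, R)` started at `v` ever returns
to `v`. The vertex set carries the discrete σ-algebra. -/
def returnProbability (H : SimpleGraph V) (R : Resistances H) (v : V) : ℝ≥0∞ :=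
  letI : MeasurableSpace V := ⊤
  haveI : DiscreteMeasurableSpace V := ⟨fun _ => trivial⟩
  chainLaw (stepLaw H R) v {x | ∃ n, 0 < n ∧ x n = v}

/-- The walk on `(H, R)` started at `v` has positive probability of never returning to `v`. -/
def TransientFrom (H : SimpleGraph V) (R : Resistances H) (v : V) : Prop :=
  returnProbability H R v < 1

/-- The random walk on the network `(H, R)` is transient. -/
def IsTransient (H : SimpleGraph V) (R : Resistances H) : Prop :=
  ∀ v, TransientFrom H R v

/-- A unit flow from `v` to infinity: an antisymmetric function on oriented edges with net
outflow `1` at `v` and `0` at every other vertex. -/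
structure IsUnitFlow (G : SimpleGraph V) [G.LocallyFinite] (v : V) (F : V → V → ℝ) : Prop where
  antisymm : ∀ x y, F y x = -F x y
  support : ∀ x y, ¬ G.Adj x y → F x y = 0
  source : ∑ y ∈ G.neighborFinset v, F v y = 1
  kirchhoff : ∀ x, x ≠ v → ∑ y ∈ G.neighborFinset x, F x y = 0

/-- The energy `∑_e F(e)² R(e)`; every edge carries two darts, whence the factor `1/2`. -/
def energy (G : SimpleGraph V) (R : Resistances G) (F : V → V → ℝ) : ℝ≥0∞ :=
  (∑' d : G.Dart, ENNReal.ofReal (F d.fst d.snd ^ 2 * (R ⟨d.edge, d.edge_mem⟩ : ℝ))) / 2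

/-- The effective resistance from `v` to infinity: the least energy of a unit flow from `v` to
infinity (it is `∞` if there is no such flow of finite energy). -/
def effectiveResistance (G : SimpleGraph V) [G.LocallyFinite] (R : Resistances G) (v : V) :
    ℝ≥0∞ :=
  ⨅ (F : V → V → ℝ) (_ : IsUnitFlow G v F), energy G R F

/-- The law of an i.i.d. family of resistances with common law `μ`, one for each edge. -/
def iidResistances (G : SimpleGraph V) (μ : Measure (Set.Ioi (0 : ℝ))) :
    Measure (Resistances G) :=
  Measure.infinitePi fun _ : G.edgeSet => μ

/-- Independent bond percolation: every edge is open (`true`) with probability `p`. -/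
def bondPercolation (G : SimpleGraph V) (p : unitInterval) : Measure (G.edgeSet → Bool) :=
  Measure.infinitePi fun _ : G.edgeSet => bernoulliMeasure true false p

/-- The graph on all vertices whose edges are the open edges. -/
def openSubgraph (G : SimpleGraph V) (ω : G.edgeSet → Bool) : SimpleGraph V where
  Adj v w := ∃ h : G.Adj v w, ω ⟨s(v, w), h⟩ = true
  symm := ⟨fun v w ⟨h, hω⟩ => ⟨h.symm, by simpa only [Sym2.eq_swap] using hω⟩⟩
  loopless := ⟨fun _ ⟨h, _⟩ => h.ne rfl⟩

/-- Simple random walk on the connected component `C` of `H` is transient. A walk on `H` that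
starts in `C` stays in `C` and is there simple random walk on the graph `C`. -/
def TransientCluster (H : SimpleGraph V) (C : H.ConnectedComponent) : Prop :=
  ∀ v ∈ C.supp, TransientFrom H (unitResistances H) v

end RandomNetwork

end

open MeasureTheory ProbabilityTheory
open scoped ENNReal

noncomputable section

namespace RandomNetwork

/-! Transience is recast as positive capacity, a condition monotone in the conductances. Let h_n(x)
be the probability that the walk from x visits o within n steps (`hitWithin`). The Laplacian of h_n
at o is the total conductance at o times the probability of no return during the first n + 1 steps,
so the walk escapes from o iff these numbers stay away from 0. Since h_n has finite support and
nonpositive Laplacian off o, summation by parts bounds its energy by its Laplacian at o; conversely,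
pairing h_n with a test function and using Cauchy–Schwarz bounds the capacity from below. This gives
`posCapacity_iff` and `transientFrom_iff`. Positive capacity is also equivalent to the existence of
a unit flow of finite energy (`IsUnitFlow.posCapacity`, `PosCapacity.exists_flow`).

For (i), keep the flow that has finite energy for unit resistances: its expected energy for random
resistances is that energy times the mean of μ, hence almost surely finite.

For (b) ⇒ (a), choose M so that resistances at most M have probability above p. Independent thinning
of these edges yields percolation with parameter p, on whose clusters the random conductances are at
least 1/M. So the network is transient with positive probability, and `infinitePi_zero_or_one`
raises this to 1.

For (a) ⇒ (b), suppose all percolations with p < 1 are recurrent. Give the edges i.i.d. integer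
labels. For each k the edges with label below k form a recurrent graph, so some h_n on it has tiny
energy with high probability, and its support lies in a finite set independent of the labels. If
resistances grow fast enough with the label, the remaining edges add almost nothing to this energy.
Borel–Cantelli then gives capacity zero almost surely (`exists_not_ae_isTransient`). -/

open Filter Topology

/-! ### Potential theory on locally finite networks: Laplacian, energy, capacity. -/

section Potential

variable {V : Type*}

/-- Symmetric nonnegative conductances carried by the edges of `G`; the value `0` is allowed. -/
structure IsConductance (G : SimpleGraph V) (c : V → V → ℝ) : Prop where
  symm : ∀ x y, c x y = c y x
  nonneg : ∀ x y, 0 ≤ c x y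
  adj : ∀ x y, c x y ≠ 0 → G.Adj x y

/-- Twice the Dirichlet energy of `f` on the edges inside `T`. -/
def energyOn (c : V → V → ℝ) (T : Finset V) (f : V → ℝ) : ℝ :=
  ∑ x ∈ T, ∑ y ∈ T, c x y * (f x - f y) ^ 2

variable (G : SimpleGraph V) [G.LocallyFinite]

open Classical in
/-- A finite set of vertices together with all neighbours. -/
def closedNbhd (S : Finset V) : Finset V := S ∪ S.biUnion fun x => G.neighborFinset x

/-- The total conductance at a vertex. -/
def totalConductance (c : V → V → ℝ) (x : V) : ℝ := ∑ y ∈ G.neighborFinset x, c x y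

/-- The network Laplacian. -/
def laplacian (c : V → V → ℝ) (f : V → ℝ) (x : V) : ℝ :=
  ∑ y ∈ G.neighborFinset x, c x y * (f x - f y)

open Classical in
/-- The average of `f` after one step of the walk from `x`. -/
def stepMean (c : V → V → ℝ) (f : V → ℝ) (x : V) : ℝ :=
  if totalConductance G c x = 0 then f x
  else (∑ y ∈ G.neighborFinset x, c x y * f y) / totalConductance G c x

open Classical in
/-- The probability that the walk started at `x` visits `o` within `n` steps. -/
def hitWithin (c : V → V → ℝ) (o : V) : ℕ → V → ℝ
  | 0 => fun x => if x = o then 1 else 0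
  | n + 1 => fun x => if x = o then 1 else stepMean G c (hitWithin c o n) x

/-- A finite set that contains all vertices at distance at most `n` from `o`. -/
def ballFinset (o : V) : ℕ → Finset V
  | 0 => {o}
  | n + 1 => closedNbhd G (ballFinset o n)

/-- The capacity of `o` is positive: finitely supported functions with value `1` at `o` have
energies bounded away from `0`. -/
def PosCapacity (c : V → V → ℝ) (o : V) : Prop :=
  ∃ κ > 0, ∀ (S : Finset V) (g : V → ℝ), (∀ x ∉ S, g x = 0) → g o = 1 →
    κ ≤ energyOn c (closedNbhd G S) g

variable {G}

lemma subset_closedNbhd (S : Finset V) : S ⊆ closedNbhd G S := by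
  classical
  exact Finset.subset_union_left

lemma mem_closedNbhd_of_adj {S : Finset V} {x y : V} (hx : x ∈ S) (h : G.Adj x y) :
    y ∈ closedNbhd G S := by
  classical
  exact Finset.mem_union_right _ (Finset.mem_biUnion.2 ⟨x, hx, by simpa using h⟩)

lemma self_mem_ballFinset (o : V) : ∀ n, o ∈ ballFinset G o n
  | 0 => Finset.mem_singleton_self o
  | n + 1 => subset_closedNbhd _ (self_mem_ballFinset o n)

lemma exists_mem_ballFinset (hG : G.Connected) (o x : V) : ∃ n, x ∈ ballFinset G o n := by
  obtain ⟨p⟩ := hG.preconnected o x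
  suffices H : ∀ {a b : V} (_ : G.Walk a b) (n : ℕ), a ∈ ballFinset G o n →
      ∃ m, b ∈ ballFinset G o m from H p 0 (self_mem_ballFinset o 0)
  intro a b q
  induction q with
  | nil => exact fun n hn => ⟨n, hn⟩
  | cons h _ ih => exact fun n hn => ih (n + 1) (mem_closedNbhd_of_adj hn h)

/-- Finite balls exhaust the graph. Countability lets almost sure statements be combined over all
vertices. -/
lemma countable_of_connected (hG : G.Connected) : Countable V := by
  obtain ⟨o⟩ := hG.nonempty
  refine Set.countable_univ_iff.1 ((Set.countable_iUnion fun n =>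
    (ballFinset G o n).finite_toSet.countable).mono fun x _ => ?_)
  simpa using exists_mem_ballFinset hG o x

/-- Summation by parts for an antisymmetric function on the oriented edges. -/
lemma sum_antisymm_mul_sub {A : V → V → ℝ} (hA : ∀ x y, A y x = -A x y)
    (hadj : ∀ x y, A x y ≠ 0 → G.Adj x y) {S T : Finset V} (hT : closedNbhd G S ⊆ T)
    {g : V → ℝ} (hg : ∀ x ∉ S, g x = 0) :
    ∑ x ∈ T, ∑ y ∈ T, A x y * (g x - g y) =
      2 * ∑ x ∈ S, g x * ∑ y ∈ G.neighborFinset x, A x y := by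
  have h1 : ∑ x ∈ T, ∑ y ∈ T, A x y * (g x - g y) = 2 * ∑ x ∈ T, g x * ∑ y ∈ T, A x y := by
    have h2 : ∑ x ∈ T, ∑ y ∈ T, A x y * g y = -∑ x ∈ T, ∑ y ∈ T, A x y * g x := by
      rw [Finset.sum_comm, ← Finset.sum_neg_distrib]
      refine Finset.sum_congr rfl fun x _ => ?_
      rw [← Finset.sum_neg_distrib]
      exact Finset.sum_congr rfl fun y _ => by rw [hA x y]; ring
    simp only [mul_sub, Finset.sum_sub_distrib, h2, Finset.mul_sum]
    rw [sub_neg_eq_add, ← two_mul, Finset.mul_sum]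
    simp only [Finset.mul_sum]
    exact Finset.sum_congr rfl fun x _ => Finset.sum_congr rfl fun y _ => by ring
  rw [h1, ← Finset.sum_subset ((subset_closedNbhd S).trans hT)
    fun x _ hx => by rw [hg x hx, zero_mul]]
  congr 1
  refine Finset.sum_congr rfl fun x hx => ?_
  congr 1
  symm
  refine Finset.sum_subset (fun y hy => hT (mem_closedNbhd_of_adj hx (by simpa using hy)))
    fun y _ hy => ?_
  by_contra h
  exact hy (by simpa using hadj x y h)

variable {c c' : V → V → ℝ} {o : V}

omit [G.LocallyFinite] in
lemma energyOn_mono (hc : IsConductance G c) {S T : Finset V} (h : S ⊆ T) (f : V → ℝ) :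
    energyOn c S f ≤ energyOn c T f := by
  have h0 : ∀ x y, 0 ≤ c x y * (f x - f y) ^ 2 := fun x y =>
    mul_nonneg (hc.nonneg x y) (sq_nonneg _)
  calc energyOn c S f ≤ ∑ x ∈ S, ∑ y ∈ T, c x y * (f x - f y) ^ 2 :=
        Finset.sum_le_sum fun x _ => Finset.sum_le_sum_of_subset_of_nonneg h fun y _ _ => h0 x y
    _ ≤ _ := Finset.sum_le_sum_of_subset_of_nonneg h fun x _ _ => Finset.sum_nonneg fun y _ => h0 x y

lemma sum_sum_mul_sq_le (T : Finset V) (a b : V → V → ℝ) :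
    (∑ x ∈ T, ∑ y ∈ T, a x y * b x y) ^ 2 ≤
      (∑ x ∈ T, ∑ y ∈ T, a x y ^ 2) * ∑ x ∈ T, ∑ y ∈ T, b x y ^ 2 := by
  simp only [← Finset.sum_product']
  exact Finset.sum_mul_sq_le_sq_mul_sq _ _ _

lemma laplacian_pairing (hc : IsConductance G c) {S T : Finset V} (hT : closedNbhd G S ⊆ T)
    {g : V → ℝ} (hg : ∀ x ∉ S, g x = 0) (f : V → ℝ) :
    ∑ x ∈ T, ∑ y ∈ T, c x y * (f x - f y) * (g x - g y) =
      2 * ∑ x ∈ S, g x * laplacian G c f x :=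
  sum_antisymm_mul_sub (fun x y => by rw [hc.symm x y]; ring)
    (fun x y h => hc.adj x y (left_ne_zero_of_mul h)) hT hg

lemma energyOn_eq (hc : IsConductance G c) {S T : Finset V} (hT : closedNbhd G S ⊆ T)
    {g : V → ℝ} (hg : ∀ x ∉ S, g x = 0) :
    energyOn c T g = 2 * ∑ x ∈ S, g x * laplacian G c g x := by
  rw [← laplacian_pairing hc hT hg, energyOn]
  exact Finset.sum_congr rfl fun x _ => Finset.sum_congr rfl fun y _ => by ring

/-- Cauchy–Schwarz for the Dirichlet form, each conductance being split as a product of two square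
roots. Only `g` has to vanish off `S`. -/
lemma laplacian_pairing_sq_le (hc : IsConductance G c) {S T : Finset V}
    (hT : closedNbhd G S ⊆ T) {g : V → ℝ} (hg : ∀ x ∉ S, g x = 0) (f : V → ℝ) :
    (2 * ∑ x ∈ S, g x * laplacian G c f x) ^ 2 ≤ energyOn c T f * energyOn c T g := by
  have h := sum_sum_mul_sq_le T (fun x y => √(c x y) * (f x - f y))
    (fun x y => √(c x y) * (g x - g y))
  have e : ∀ (x y : V) (a b : ℝ), √(c x y) * a * (√(c x y) * b) = c x y * a * b := fun x y a b => by
    rw [mul_mul_mul_comm, Real.mul_self_sqrt (hc.nonneg x y), mul_assoc]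
  simp only [e, mul_pow, Real.sq_sqrt (hc.nonneg _ _)] at h
  rw [← laplacian_pairing hc hT hg]
  exact h

lemma totalConductance_nonneg (hc : IsConductance G c) (x : V) : 0 ≤ totalConductance G c x :=
  Finset.sum_nonneg fun y _ => hc.nonneg x y

lemma eq_zero_of_totalConductance (hc : IsConductance G c) {x : V}
    (h : totalConductance G c x = 0) (y : V) : c x y = 0 := by
  by_contra hy
  exact hy ((Finset.sum_eq_zero_iff_of_nonneg fun y _ => hc.nonneg x y).1 h y
    (by simpa using hc.adj x y hy))

lemma laplacian_eq (hc : IsConductance G c) (f : V → ℝ) (x : V) :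
    laplacian G c f x = totalConductance G c x * (f x - stepMean G c f x) := by
  unfold stepMean
  split_ifs with h
  · simp [laplacian, eq_zero_of_totalConductance hc h]
  · rw [mul_sub, mul_div_cancel₀ _ h]
    simp [laplacian, totalConductance, mul_sub, Finset.sum_mul]

lemma stepMean_mono (hc : IsConductance G c) {f g : V → ℝ} (h : ∀ x, f x ≤ g x) (x : V) :
    stepMean G c f x ≤ stepMean G c g x := by
  unfold stepMean
  split_ifs with h0
  · exact h x
  · exact div_le_div_of_nonneg_right
      (Finset.sum_le_sum fun y _ => mul_le_mul_of_nonneg_left (h y) (hc.nonneg x y))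
      (totalConductance_nonneg hc x)

lemma stepMean_const (a : ℝ) (x : V) : stepMean G c (fun _ => a) x = a := by
  unfold stepMean
  split_ifs with h0
  · rfl
  · rw [← Finset.sum_mul]
    exact mul_div_cancel_left₀ _ h0

lemma hitWithin_self (n : ℕ) : hitWithin G c o n o = 1 := by
  cases n <;> simp [hitWithin]

lemma hitWithin_succ_of_ne (n : ℕ) {x : V} (h : x ≠ o) :
    hitWithin G c o (n + 1) x = stepMean G c (hitWithin G c o n) x := by
  simp [hitWithin, h]

lemma hitWithin_nonneg (hc : IsConductance G c) (n : ℕ) : ∀ x, 0 ≤ hitWithin G c o n x := by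
  induction n with
  | zero => intro x; simp only [hitWithin]; split_ifs <;> norm_num
  | succ n ih =>
    intro x
    by_cases h : x = o
    · simp [h, hitWithin_self]
    · rw [hitWithin_succ_of_ne n h]
      simpa [stepMean_const] using stepMean_mono hc ih x

lemma hitWithin_le_one (hc : IsConductance G c) (n : ℕ) : ∀ x, hitWithin G c o n x ≤ 1 := by
  induction n with
  | zero => intro x; simp only [hitWithin]; split_ifs <;> norm_num
  | succ n ih =>
    intro x
    by_cases h : x = o
    · simp [h, hitWithin_self]
    · rw [hitWithin_succ_of_ne n h]
      simpa [stepMean_const] using stepMean_mono hc ih x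

lemma hitWithin_le_succ (hc : IsConductance G c) (n : ℕ) :
    ∀ x, hitWithin G c o n x ≤ hitWithin G c o (n + 1) x := by
  induction n with
  | zero =>
    intro x
    by_cases h : x = o
    · simp [h, hitWithin_self]
    · exact (le_of_eq (by simp [hitWithin, h])).trans (hitWithin_nonneg hc 1 x)
  | succ n ih =>
    intro x
    by_cases h : x = o
    · simp [h, hitWithin_self]
    · rw [hitWithin_succ_of_ne n h, hitWithin_succ_of_ne (n + 1) h]
      exact stepMean_mono hc ih x

lemma hitWithin_monotone (hc : IsConductance G c) (x : V) :
    Monotone fun n => hitWithin G c o n x :=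
  monotone_nat_of_le_succ fun n => hitWithin_le_succ hc n x

lemma hitWithin_eq_zero (n : ℕ) :
    ∀ x ∉ ballFinset G o n, hitWithin G c o n x = 0 := by
  induction n with
  | zero => intro x hx; simpa [hitWithin, ballFinset] using hx
  | succ n ih =>
    intro x hx
    have h : x ≠ o := fun h => hx (by rw [h]; exact self_mem_ballFinset o _)
    rw [hitWithin_succ_of_ne n h]
    unfold stepMean
    split_ifs with h0
    · exact ih x fun hx' => hx (subset_closedNbhd _ hx')
    · rw [Finset.sum_eq_zero, zero_div]
      intro y hy
      rw [ih y fun hy' => hx (mem_closedNbhd_of_adj hy' (by simpa using G.adj_symm (by simpa using hy))),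
        mul_zero]

lemma laplacian_hitWithin_of_ne (hc : IsConductance G c) (n : ℕ) {x : V} (h : x ≠ o) :
    laplacian G c (hitWithin G c o n) x =
      totalConductance G c x * (hitWithin G c o n x - hitWithin G c o (n + 1) x) := by
  rw [laplacian_eq hc, hitWithin_succ_of_ne n h]

lemma laplacian_hitWithin_nonpos (hc : IsConductance G c) (n : ℕ) {x : V} (h : x ≠ o) :
    laplacian G c (hitWithin G c o n) x ≤ 0 := by
  rw [laplacian_hitWithin_of_ne hc n h]
  exact mul_nonpos_of_nonneg_of_nonpos (totalConductance_nonneg hc x)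
    (sub_nonpos.2 (hitWithin_le_succ hc n x))

/-- The value at `o` is pinned at 1 while the values at its neighbours increase with `n`. -/
lemma laplacian_hitWithin_self_antitone (hc : IsConductance G c) :
    Antitone fun n => laplacian G c (hitWithin G c o n) o := by
  intro m n hmn
  refine Finset.sum_le_sum fun y _ => mul_le_mul_of_nonneg_left ?_ (hc.nonneg o y)
  rw [hitWithin_self, hitWithin_self]
  linarith [hitWithin_monotone (o := o) hc y hmn]

/-- The energy of the hitting probabilities is controlled by their Laplacian at the target. -/
lemma energyOn_hitWithin_le (hc : IsConductance G c) (n : ℕ) (T : Finset V) :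
    energyOn c T (hitWithin G c o n) ≤ 2 * laplacian G c (hitWithin G c o n) o := by
  classical
  -- Enlarging `T` to contain the support and its neighbours makes summation by parts available;
  -- then every term off `o` is nonpositive.
  refine (energyOn_mono hc (T := T ∪ closedNbhd G (ballFinset G o n))
    Finset.subset_union_left _).trans ?_
  rw [energyOn_eq hc Finset.subset_union_right (hitWithin_eq_zero n),
    ← Finset.add_sum_erase _ _ (self_mem_ballFinset o n), hitWithin_self, one_mul]
  have : ∑ x ∈ (ballFinset G o n).erase o,
      hitWithin G c o n x * laplacian G c (hitWithin G c o n) x ≤ 0 :=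
    Finset.sum_nonpos fun x hx => mul_nonpos_of_nonneg_of_nonpos (hitWithin_nonneg hc n x)
      (laplacian_hitWithin_nonpos hc n (Finset.ne_of_mem_erase hx))
  linarith

lemma exists_tendsto_hitWithin (hc : IsConductance G c) (x : V) :
    Tendsto (fun n => hitWithin G c o n x) atTop (𝓝 (⨆ n, hitWithin G c o n x)) :=
  tendsto_atTop_ciSup (hitWithin_monotone hc x)
    ⟨1, by rintro _ ⟨n, rfl⟩; exact hitWithin_le_one hc n x⟩

/-- Off `o` the Laplacian is a multiple of the increment from `n` to `n + 1` of a convergent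
sequence: the limit function is harmonic there. -/
lemma tendsto_laplacian_hitWithin_of_ne (hc : IsConductance G c) {x : V} (h : x ≠ o) :
    Tendsto (fun n => laplacian G c (hitWithin G c o n) x) atTop (𝓝 0) := by
  have h1 := exists_tendsto_hitWithin (o := o) hc x
  have h2 := (h1.sub ((tendsto_add_atTop_iff_nat 1).2 h1)).const_mul (totalConductance G c x)
  simpa [laplacian_hitWithin_of_ne hc _ h] using h2

/-- The walk escapes from `o` exactly when the capacity of `o` is positive. -/
theorem posCapacity_iff (hc : IsConductance G c) :
    PosCapacity G c o ↔ ∃ δ > 0, ∀ n, δ ≤ laplacian G c (hitWithin G c o n) o := by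
  classical
  constructor
  · rintro ⟨κ, hκ, h⟩
    refine ⟨κ / 2, half_pos hκ, fun n => ?_⟩
    have h1 := h (ballFinset G o n) (hitWithin G c o n) (hitWithin_eq_zero n)
      (hitWithin_self n)
    linarith [energyOn_hitWithin_le (o := o) hc n (closedNbhd G (ballFinset G o n))]
  · rintro ⟨δ, hδ, h⟩
    refine ⟨2 * δ, by positivity, fun S g hg ho => ?_⟩
    set L : ℝ := ⨅ n, laplacian G c (hitWithin G c o n) o with hL
    have hlim : Tendsto (fun n => laplacian G c (hitWithin G c o n) o) atTop (𝓝 L) :=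
      tendsto_atTop_ciInf (laplacian_hitWithin_self_antitone hc)
        ⟨δ, by rintro _ ⟨n, rfl⟩; exact h n⟩
    have hδL : δ ≤ L := le_ciInf h
    have hoS : o ∈ S := by
      by_contra hoS
      exact zero_ne_one ((hg o hoS).symm.trans ho)
    -- In the limit the pairing with `g` sees only the vertex `o`, where `g` is 1, so it tends to
    -- `L`. Cauchy–Schwarz then gives (2L)² ≤ 2L·E.
    have hsum : Tendsto (fun n => ∑ x ∈ S, g x * laplacian G c (hitWithin G c o n) x) atTop
        (𝓝 (∑ x ∈ S, g x * if x = o then L else 0)) := by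
      refine tendsto_finsetSum _ fun x _ => Tendsto.const_mul _ ?_
      split_ifs with hx
      · exact hx ▸ hlim
      · exact tendsto_laplacian_hitWithin_of_ne hc hx
    have hval : ∑ x ∈ S, g x * (if x = o then L else 0) = L := by
      simp [hoS, ho]
    rw [hval] at hsum
    set E := energyOn c (closedNbhd G S) g
    have hE : 0 ≤ E := Finset.sum_nonneg fun x _ => Finset.sum_nonneg fun y _ =>
      mul_nonneg (hc.nonneg x y) (sq_nonneg _)
    have hineq : (2 * L) ^ 2 ≤ 2 * L * E := by
      refine le_of_tendsto_of_tendsto' ((hsum.const_mul 2).pow 2)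
        ((hlim.const_mul 2).mul_const E) fun n => ?_
      exact (laplacian_pairing_sq_le hc subset_rfl hg _).trans
        (mul_le_mul_of_nonneg_right (energyOn_hitWithin_le hc n _) hE)
    have hLpos : 0 < 2 * L := by linarith
    have : 2 * L ≤ E := le_of_mul_le_mul_left (by rwa [sq] at hineq) hLpos
    linarith

lemma PosCapacity.of_le (h : PosCapacity G c o) {K : ℝ} (hK : 0 < K)
    (hle : ∀ x y, K * c x y ≤ c' x y) : PosCapacity G c' o := by
  obtain ⟨κ, hκ, h⟩ := h
  refine ⟨K * κ, mul_pos hK hκ, fun S g hg ho => ?_⟩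
  refine (mul_le_mul_of_nonneg_left (h S g hg ho) hK.le).trans ?_
  simp only [energyOn, Finset.mul_sum]
  refine Finset.sum_le_sum fun x _ => Finset.sum_le_sum fun y _ => ?_
  rw [← mul_assoc]
  exact mul_le_mul_of_nonneg_right (hle x y) (sq_nonneg _)

lemma PosCapacity.of_adj (hc : IsConductance G c) {v w : V} (h : PosCapacity G c v)
    (hvw : 0 < c w v) : PosCapacity G c w := by
  obtain ⟨κ, hκ, h⟩ := h
  refine ⟨min (c w v / 4) (κ / 4), by positivity, fun S g hg hw => ?_⟩
  set T := closedNbhd G S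
  have hwS : w ∈ S := by
    by_contra hwS
    exact zero_ne_one ((hg w hwS).symm.trans hw)
  have hnn : ∀ x y, 0 ≤ c x y * (g x - g y) ^ 2 := fun x y =>
    mul_nonneg (hc.nonneg x y) (sq_nonneg _)
  have hterm : c w v * (g w - g v) ^ 2 ≤ energyOn c T g := by
    have h1 := Finset.single_le_sum (f := fun y => c w y * (g w - g y) ^ 2)
      (fun y _ => hnn w y) (mem_closedNbhd_of_adj hwS (hc.adj _ _ hvw.ne'))
    have h2 := Finset.single_le_sum (f := fun x => ∑ y ∈ T, c x y * (g x - g y) ^ 2)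
      (fun x _ => Finset.sum_nonneg fun y _ => hnn x y) (subset_closedNbhd (G := G) S hwS)
    exact h1.trans h2
  -- Either the edge `wv` alone carries a drop of at least 1/2, or `g / g v` is a test function for
  -- `v` and rescaling costs at most a factor 4.
  by_cases hv : g v ≤ 1 / 2
  · refine (min_le_left _ _).trans (le_trans ?_ hterm)
    rw [hw, div_eq_mul_one_div]
    exact mul_le_mul_of_nonneg_left (by nlinarith) hvw.le
  · push Not at hv
    have hv0 : 0 < g v := by linarith
    have h1 := h S (fun x => g x / g v) (fun x hx => by simp [hg x hx]) (div_self hv0.ne')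
    have h2 : energyOn c T (fun x => g x / g v) = energyOn c T g / g v ^ 2 := by
      simp only [energyOn, Finset.sum_div]
      refine Finset.sum_congr rfl fun x _ => Finset.sum_congr rfl fun y _ => ?_
      field_simp
    rw [h2, le_div_iff₀ (by positivity)] at h1
    refine (min_le_right _ _).trans (le_trans ?_ h1)
    rw [div_eq_mul_one_div]
    exact mul_le_mul_of_nonneg_left (by nlinarith) hκ.le

lemma PosCapacity.of_reachable (hc : IsConductance G c) {H : SimpleGraph V}
    (hH : ∀ x y, H.Adj x y → 0 < c x y) {v w : V} (h : PosCapacity G c v)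
    (hvw : H.Reachable v w) : PosCapacity G c w := by
  obtain ⟨p⟩ := hvw
  induction p with
  | nil => exact h
  | cons hadj _ ih => exact ih (h.of_adj hc (hH _ _ hadj.symm))

end Potential

/-! ### Avoidance probabilities of a Markov chain as iterates of a killed kernel. -/

section Chain

variable {V : Type*}

open Classical in
/-- The expectation of `φ` after one step of the chain, on the event that the step avoids `o`. -/
def killedStep (q : V → PMF V) (o : V) (φ : V → ℝ≥0∞) (x : V) : ℝ≥0∞ :=
  ∑' y, q x y * (if y = o then 0 else φ y)

open Classical in
/-- The indicator that a trajectory avoids `o` at the times `1, …, n`. -/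
def avoidWeight (o : V) (n : ℕ) (x : ℕ → V) : ℝ≥0∞ :=
  ∏ i ∈ Finset.range n, if x (i + 1) = o then 0 else 1

/-- The law is carried by its countable support, so `V` itself need not be countable. -/
lemma lintegral_toMeasure_eq_tsum [MeasurableSpace V] [DiscreteMeasurableSpace V]
    (p : PMF V) (φ : V → ℝ≥0∞) : ∫⁻ y, φ y ∂p.toMeasure = ∑' y, p y * φ y := by
  classical
  have hcount := p.support_countable
  have h0 : p.toMeasure p.supportᶜ = 0 := by
    rw [PMF.toMeasure_apply_eq_zero_iff _ (MeasurableSet.of_discrete)]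
    exact disjoint_compl_right
  rw [← lintegral_add_compl (fun y => φ y) (MeasurableSet.of_discrete (s := p.support)),
    setLIntegral_measure_zero _ _ h0, add_zero, lintegral_countable _ hcount]
  rw [← tsum_subtype_eq_of_support_subset (s := p.support) (f := fun y => p y * φ y)]
  · refine tsum_congr fun y => ?_
    rw [PMF.toMeasure_apply_singleton _ _ MeasurableSet.of_discrete, mul_comm]
  · intro y hy
    exact left_ne_zero_of_mul hy

variable [MeasurableSpace V] [DiscreteMeasurableSpace V] (q : V → PMF V) (o : V)

instance (v : V) : IsProbabilityMeasure (chainLaw q v) := by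
  unfold chainLaw; infer_instance

/-- The Markov property: integrating out the last step replaces `φ` by `killedStep q o φ`, which is
why the induction runs over all `φ`. -/
lemma lintegral_avoidWeight_mul (v : V) (n : ℕ) (φ : V → ℝ≥0∞) :
    ∫⁻ x, avoidWeight o n x * φ (x n) ∂chainLaw q v = (killedStep q o)^[n] φ v := by
  classical
  induction n generalizing φ with
  | zero =>
    have h := Kernel.traj_map_frestrictLe_apply (X := fun _ => V) (κ := markovKernel q) 0 0
      (fun _ => v)
    rw [Kernel.partialTraj_self, Kernel.id_apply] at h
    have hφ : Measurable fun y : (Π _ : Finset.Iic 0, V) => φ (y ⟨0, Finset.mem_Iic.2 le_rfl⟩) :=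
      (Measurable.of_discrete (f := φ)).comp (measurable_pi_apply _)
    have h1 : ∫⁻ y, φ (y ⟨0, Finset.mem_Iic.2 le_rfl⟩) ∂((chainLaw q v).map
        (Preorder.frestrictLe (π := fun _ => V) 0)) = φ v := by
      unfold chainLaw
      rw [h, lintegral_dirac' _ hφ]
    rw [lintegral_map hφ (Preorder.measurable_frestrictLe _)] at h1
    simpa [avoidWeight] using h1
  | succ n ih =>
    rw [Function.iterate_succ_apply, ← ih]
    -- `W` is the avoidance weight as a function of the path up to time `n`, the form in which the
    -- kernel for the next step can be applied.
    let W : (Π _ : Finset.Iic n, V) → ℝ≥0∞ := fun y =>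
      ∏ i ∈ (Finset.range n).attach, if y ⟨i.1 + 1, Finset.mem_Iic.2
        (Nat.succ_le_of_lt (Finset.mem_range.1 i.2))⟩ = o then 0 else 1
    have hW : Measurable W := Finset.measurable_prod _ fun i _ =>
      (Measurable.of_discrete (f := fun z : V => if z = o then (0 : ℝ≥0∞) else 1)).comp
        (measurable_pi_apply _)
    have hWx : ∀ x : ℕ → V, W (Preorder.frestrictLe (π := fun _ => V) n x) = avoidWeight o n x := by
      intro x
      simp only [W, avoidWeight, Preorder.frestrictLe_apply]
      exact Finset.prod_attach (Finset.range n) fun i => if x (i + 1) = o then (0 : ℝ≥0∞) else 1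
    let ψ : V → ℝ≥0∞ := fun z => if z = o then 0 else φ z
    have hψ : Measurable ψ := .of_discrete
    have h := Kernel.partialTraj_compProd_eq_map_traj (X := fun _ => V) (κ := markovKernel q)
      (Nat.zero_le n) (x₀ := fun _ => v)
    have hm : Measurable fun p : (Π _ : Finset.Iic n, V) × V => W p.1 * ψ p.2 :=
      (hW.comp measurable_fst).mul (hψ.comp measurable_snd)
    have hfr := Preorder.measurable_frestrictLe (X := fun _ : ℕ => V) n
    have h1 : ∫⁻ x, avoidWeight o (n + 1) x * φ (x (n + 1)) ∂chainLaw q v =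
        ∫⁻ p, W p.1 * ψ p.2 ∂((chainLaw q v).map
          fun x => (Preorder.frestrictLe (π := fun _ => V) n x, x (n + 1))) := by
      rw [lintegral_map hm (hfr.prodMk (measurable_pi_apply _))]
      refine lintegral_congr fun x => ?_
      simp only [hWx, ψ, avoidWeight, Finset.prod_range_succ]
      split_ifs <;> simp
    have h2 : ∫⁻ x, avoidWeight o n x * killedStep q o φ (x n) ∂chainLaw q v =
        ∫⁻ y, W y * killedStep q o φ (y ⟨n, Finset.mem_Iic.2 le_rfl⟩) ∂((chainLaw q v).map
          (Preorder.frestrictLe (π := fun _ => V) n)) := by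
      have hk : Measurable fun y : (Π _ : Finset.Iic n, V) =>
          killedStep q o φ (y ⟨n, Finset.mem_Iic.2 le_rfl⟩) :=
        (Measurable.of_discrete (f := killedStep q o φ)).comp (measurable_pi_apply _)
      have hWk : Measurable fun y : (Π _ : Finset.Iic n, V) =>
          W y * killedStep q o φ (y ⟨n, Finset.mem_Iic.2 le_rfl⟩) := hW.mul hk
      rw [lintegral_map hWk hfr]
      exact lintegral_congr fun x => by rw [hWx]; rfl
    rw [h1, h2]
    unfold chainLaw
    rw [← h, Kernel.traj_map_frestrictLe_apply, Measure.lintegral_compProd hm]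
    refine lintegral_congr fun y => ?_
    change ∫⁻ z, W y * ψ z ∂(q (y ⟨n, Finset.mem_Iic.2 le_rfl⟩)).toMeasure = _
    rw [lintegral_const_mul _ hψ, lintegral_toMeasure_eq_tsum]
    rfl

lemma measurable_avoidWeight (n : ℕ) : Measurable (avoidWeight (V := V) o n) := by
  classical
  exact Finset.measurable_prod _ fun i _ =>
    (Measurable.of_discrete (f := fun z : V => if z = o then (0 : ℝ≥0∞) else 1)).comp
      (measurable_pi_apply _)

omit [MeasurableSpace V] [DiscreteMeasurableSpace V] in
lemma avoidWeight_eq_indicator (n : ℕ) (x : ℕ → V) :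
    avoidWeight o n x = {x : ℕ → V | ∀ i < n, x (i + 1) ≠ o}.indicator 1 x := by
  classical
  by_cases h : x ∈ {x : ℕ → V | ∀ i < n, x (i + 1) ≠ o}
  · rw [Set.indicator_of_mem h]
    exact Finset.prod_eq_one fun i hi => if_neg (h i (Finset.mem_range.1 hi))
  · rw [Set.indicator_of_notMem h]
    simp only [Set.mem_ofPred_eq] at h
    push Not at h
    obtain ⟨i, hi, hx⟩ := h
    exact Finset.prod_eq_zero (Finset.mem_range.2 hi) (if_pos hx)

lemma measurableSet_avoid (n : ℕ) : MeasurableSet {x : ℕ → V | ∀ i < n, x (i + 1) ≠ o} := by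
  have : {x : ℕ → V | ∀ i < n, x (i + 1) ≠ o} = avoidWeight o n ⁻¹' {1} := by
    ext x
    rw [Set.mem_preimage, avoidWeight_eq_indicator]
    by_cases h : x ∈ {x : ℕ → V | ∀ i < n, x (i + 1) ≠ o}
    · simp only [Set.indicator_of_mem h, h]; simp
    · simp only [Set.indicator_of_notMem h, h]; simp
  rw [this]
  exact measurable_avoidWeight o n (measurableSet_singleton _)

lemma chainLaw_avoid (v : V) (n : ℕ) :
    chainLaw q v {x | ∀ i < n, x (i + 1) ≠ o} = (killedStep q o)^[n] 1 v := by
  rw [← lintegral_avoidWeight_mul q o v n 1, ← lintegral_indicator_one (measurableSet_avoid o n)]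
  exact lintegral_congr fun x => by rw [avoidWeight_eq_indicator]; simp

/-- The chain returns with probability less than `1` iff the probabilities of avoiding `v` for
`n` steps are bounded away from `0`. -/
lemma chainLaw_return_lt_one_iff (v : V) :
    chainLaw q v {x | ∃ n, 0 < n ∧ x n = v} < 1 ↔ 0 < ⨅ n, (killedStep q v)^[n] 1 v := by
  have hcompl : {x : ℕ → V | ∃ n, 0 < n ∧ x n = v} =
      (⋂ n, {x : ℕ → V | ∀ i < n, x (i + 1) ≠ v})ᶜ := by
    ext x
    simp only [Set.mem_ofPred_eq, Set.mem_compl_iff, Set.mem_iInter, not_forall, not_not]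
    constructor
    · rintro ⟨n, hn, hx⟩
      exact ⟨n, n - 1, by omega, by rwa [Nat.sub_add_cancel hn]⟩
    · rintro ⟨_, i, _, hx⟩
      exact ⟨i + 1, i.succ_pos, hx⟩
  have hms : MeasurableSet (⋂ n, {x : ℕ → V | ∀ i < n, x (i + 1) ≠ v}) :=
    MeasurableSet.iInter fun n => measurableSet_avoid v n
  have hanti : Antitone fun n => {x : ℕ → V | ∀ i < n, x (i + 1) ≠ v} :=
    fun m n hmn x hx i hi => hx i (hi.trans_le hmn)
  rw [hcompl, prob_compl_eq_one_sub hms, hanti.measure_iInter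
    (fun n => (measurableSet_avoid v n).nullMeasurableSet) ⟨0, measure_ne_top _ _⟩]
  simp only [chainLaw_avoid]
  constructor
  · intro h
    refine pos_iff_ne_zero.2 fun h0 => ?_
    simp [h0] at h
  · exact fun h => ENNReal.sub_lt_self ENNReal.one_ne_top one_ne_zero h.ne'

end Chain

/-! ### The walk on a network: transience equals positive capacity. -/

section Network

variable {V : Type*} {G H : SimpleGraph V} [G.LocallyFinite]

open Classical in
/-- The real conductances of a network on `H`. -/
def realConductance (H : SimpleGraph V) (R : Resistances H) (x y : V) : ℝ :=
  if h : H.Adj x y then (R ⟨s(x, y), h⟩ : ℝ)⁻¹ else 0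

lemma conductance_eq (R : Resistances H) (x y : V) :
    conductance H R x y = ENNReal.ofReal (realConductance H R x y) := by
  unfold conductance realConductance
  split_ifs <;> simp

lemma realConductance_pos (R : Resistances H) {x y : V} (h : H.Adj x y) :
    0 < realConductance H R x y := by
  rw [realConductance, dif_pos h]
  exact inv_pos.2 (R _).2

omit [G.LocallyFinite] in
lemma isConductance_realConductance (hHG : H ≤ G) (R : Resistances H) :
    IsConductance G (realConductance H R) where
  symm x y := by
    unfold realConductance
    by_cases h : H.Adj x y
    · rw [dif_pos h, dif_pos h.symm]
      congr 4
      exact Sym2.eq_swap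
    · rw [dif_neg h, dif_neg fun h' => h h'.symm]
  nonneg x y := by
    by_cases h : H.Adj x y
    · exact (realConductance_pos R h).le
    · rw [realConductance, dif_neg h]
  adj x y h := by
    by_contra h'
    exact h (dif_neg fun h'' => h' (hHG h''))

lemma tsum_conductance_mul (hHG : H ≤ G) (R : Resistances H) (x : V) {f : V → ℝ}
    (hf : ∀ y, 0 ≤ f y) :
    ∑' y, conductance H R x y * ENNReal.ofReal (f y) =
      ENNReal.ofReal (∑ y ∈ G.neighborFinset x, realConductance H R x y * f y) := by
  have hc := isConductance_realConductance hHG R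
  rw [ENNReal.ofReal_sum_of_nonneg fun y _ => mul_nonneg (hc.nonneg x y) (hf y),
    tsum_eq_sum (s := G.neighborFinset x)]
  · exact Finset.sum_congr rfl fun y _ => by
      rw [conductance_eq, ENNReal.ofReal_mul (hc.nonneg x y)]
  · intro y hy
    rw [conductance_eq]
    have : realConductance H R x y = 0 := by
      by_contra h
      exact hy (by simpa using hc.adj x y h)
    simp [this]

lemma tsum_stepLaw_mul (hHG : H ≤ G) (R : Resistances H) (x : V) {f : V → ℝ}
    (hf : ∀ y, 0 ≤ f y) :
    ∑' y, stepLaw H R x y * ENNReal.ofReal (f y) =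
      ENNReal.ofReal (stepMean G (realConductance H R) f x) := by
  classical
  have hc := isConductance_realConductance hHG R
  have htot : ∑' y, conductance H R x y =
      ENNReal.ofReal (totalConductance G (realConductance H R) x) := by
    simpa [totalConductance] using tsum_conductance_mul hHG R x (f := 1) fun _ => zero_le_one
  have hnn := totalConductance_nonneg hc x
  unfold stepMean stepLaw
  by_cases h0 : totalConductance G (realConductance H R) x = 0
  · rw [if_pos h0, dif_neg (by rw [htot, h0]; simp)]
    rw [tsum_eq_single x fun y hy => by simp [hy]]
    simp
  · have hpos : 0 < totalConductance G (realConductance H R) x := lt_of_le_of_ne hnn (Ne.symm h0)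
    have hcond : (∑' z, conductance H R x z) ≠ 0 ∧ (∑' z, conductance H R x z) ≠ ∞ := by
      rw [htot]
      exact ⟨by simpa using hpos, ENNReal.ofReal_ne_top⟩
    rw [if_neg h0, dif_pos hcond, ENNReal.ofReal_div_of_pos hpos, ← tsum_conductance_mul hHG R x hf,
      ← htot, div_eq_mul_inv, ← ENNReal.tsum_mul_right]
    exact tsum_congr fun y => by rw [PMF.normalize_apply]; ring

lemma stepMean_one_sub {c : V → V → ℝ} (f : V → ℝ) (x : V) :
    stepMean G c (fun y => 1 - f y) x = 1 - stepMean G c f x := by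
  unfold stepMean
  split_ifs with h0
  · rfl
  · simp only [mul_sub, mul_one, Finset.sum_sub_distrib]
    rw [sub_div]
    congr 1
    exact div_self h0

/-- First-step analysis. `hitWithin` counts a visit at time 0, whereas the killed chain looks only
at times from 1 on; hence `n + 1` against `n` and the extra `stepMean`. -/
lemma killedStep_iterate (hHG : H ≤ G) (R : Resistances H) (o : V) (n : ℕ) (x : V) :
    (killedStep (stepLaw H R) o)^[n + 1] 1 x =
      ENNReal.ofReal (1 - stepMean G (realConductance H R)
        (hitWithin G (realConductance H R) o n) x) := by
  classical
  have hc := isConductance_realConductance hHG R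
  induction n generalizing x with
  | zero =>
    rw [← stepMean_one_sub, ← tsum_stepLaw_mul hHG R x fun y => sub_nonneg.2 (hitWithin_le_one hc 0 y)]
    refine tsum_congr fun y => ?_
    simp only [hitWithin]
    split_ifs <;> simp
  | succ n ih =>
    rw [Function.iterate_succ_apply', ← stepMean_one_sub,
      ← tsum_stepLaw_mul hHG R x fun y => sub_nonneg.2 (hitWithin_le_one hc (n + 1) y)]
    refine tsum_congr fun y => ?_
    split_ifs with hy
    · simp [hy, hitWithin_self]
    · rw [ih, hitWithin_succ_of_ne n hy]

/-- Transience is positivity of the capacity. -/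
theorem transientFrom_iff (hHG : H ≤ G) (R : Resistances H) (v : V) :
    TransientFrom H R v ↔ PosCapacity G (realConductance H R) v := by
  have hc := isConductance_realConductance hHG R
  let _ : MeasurableSpace V := ⊤
  have : DiscreteMeasurableSpace V := ⟨fun _ => trivial⟩
  have h1 : TransientFrom H R v ↔ 0 < ⨅ n, (killedStep (stepLaw H R) v)^[n] 1 v :=
    chainLaw_return_lt_one_iff (stepLaw H R) v
  rw [h1, posCapacity_iff hc]
  simp only [laplacian_eq hc, hitWithin_self]
  constructor
  · intro h
    obtain ⟨ε, hε0, hε⟩ := ENNReal.lt_iff_exists_real_btwn.1 h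
    have hb : ∀ n, ε < 1 - stepMean G (realConductance H R)
        (hitWithin G (realConductance H R) v n) v := fun n => by
      have := hε.2.trans_le (iInf_le _ (n + 1))
      rw [killedStep_iterate hHG] at this
      exact (ENNReal.ofReal_lt_ofReal_iff_of_nonneg hε0).1 this
    have hεpos : 0 < ε := by simpa using hε.1
    -- With zero total conductance the walk stays put, `stepMean` returns the value 1 at `v`, and
    -- escape is impossible.
    have htot : totalConductance G (realConductance H R) v ≠ 0 := fun h0 => by
      have := hb 0
      rw [stepMean, if_pos h0, hitWithin_self] at this
      linarith
    have hpos := lt_of_le_of_ne (totalConductance_nonneg hc v) htot.symm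
    exact ⟨_, mul_pos hpos hεpos, fun n => mul_le_mul_of_nonneg_left (hb n).le hpos.le⟩
  · rintro ⟨δ, hδ, h⟩
    have htot : totalConductance G (realConductance H R) v ≠ 0 := fun h0 => by
      have := h 0
      rw [h0, zero_mul] at this
      linarith
    have hpos := lt_of_le_of_ne (totalConductance_nonneg hc v) htot.symm
    -- The `min` with 1 covers the zeroth iterate, which equals 1 and is not described by
    -- `killedStep_iterate`.
    have hle : ENNReal.ofReal (min 1 (δ / totalConductance G (realConductance H R) v)) ≤
        ⨅ n, (killedStep (stepLaw H R) v)^[n] 1 v := by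
      refine le_iInf fun n => ?_
      cases n with
      | zero => simp
      | succ n =>
        rw [killedStep_iterate hHG]
        refine ENNReal.ofReal_le_ofReal ((min_le_right _ _).trans ?_)
        rw [div_le_iff₀ hpos, mul_comm]
        exact h n
    refine lt_of_lt_of_le ?_ hle
    simpa using div_pos hδ hpos

end Network

/-! ### Unit flows of finite energy and capacity. -/

section Flow

variable {V : Type*} {G : SimpleGraph V}

/-- Pairs that are not edges contribute nothing, whatever `F` is there, because division by the zero
conductance gives 0. -/
lemma energy_eq_tsum (R : Resistances G) (F : V → V → ℝ) :
    energy G R F =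
      (∑' p : V × V, ENNReal.ofReal (F p.1 p.2 ^ 2 / realConductance G R p.1 p.2)) / 2 := by
  rw [energy, ← (SimpleGraph.Dart.toProd_injective (G := G)).tsum_eq
    (f := fun p : V × V => ENNReal.ofReal (F p.1 p.2 ^ 2 / realConductance G R p.1 p.2))]
  · congr 1
    refine tsum_congr fun d => ?_
    rw [realConductance, dif_pos d.adj, div_inv_eq_mul]
    rfl
  · intro p hp
    have h : G.Adj p.1 p.2 := by
      by_contra h
      exact hp (by simp [realConductance, h])
    exact ⟨⟨p, h⟩, rfl⟩

variable [G.LocallyFinite]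

/-- A unit flow of finite energy makes the capacity of its source positive. -/
lemma IsUnitFlow.posCapacity {R : Resistances G} {v : V} {F : V → V → ℝ} (hF : IsUnitFlow G v F)
    (hE : energy G R F < ∞) : PosCapacity G (realConductance G R) v := by
  classical
  set c := realConductance G R with hcdef
  have hc : IsConductance G c := isConductance_realConductance le_rfl R
  have hadj : ∀ x y, F x y ≠ 0 → G.Adj x y := fun x y h => by
    by_contra h'
    exact h (hF.support x y h')
  have hfin : (∑' p : V × V, ENNReal.ofReal (F p.1 p.2 ^ 2 / c p.1 p.2)) ≠ ∞ := fun h => by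
    rw [energy_eq_tsum, ← hcdef, h, ENNReal.top_div_of_ne_top (by simp)] at hE
    exact lt_irrefl _ hE
  set E := (∑' p : V × V, ENNReal.ofReal (F p.1 p.2 ^ 2 / c p.1 p.2)).toReal
  have hE0 : 0 ≤ E := ENNReal.toReal_nonneg
  -- The flow paired with the gradient of `g` gives 2, so Cauchy–Schwarz yields 4 ≤ E · energy.
  -- Using `E + 1` spares a proof that `E` is nonzero.
  refine ⟨4 / (E + 1), by positivity, fun S g hg hv => ?_⟩
  set T := closedNbhd G S
  have hvS : v ∈ S := by
    by_contra hvS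
    exact zero_ne_one ((hg v hvS).symm.trans hv)
  have hpair : ∑ x ∈ T, ∑ y ∈ T, F x y * (g x - g y) = 2 := by
    rw [sum_antisymm_mul_sub hF.antisymm hadj subset_rfl hg, Finset.sum_eq_single_of_mem v hvS,
      hF.source, hv]
    · norm_num
    · intro x _ hx
      rw [hF.kirchhoff x hx, mul_zero]
  have hcs := sum_sum_mul_sq_le T (fun x y => F x y / √(c x y)) (fun x y => √(c x y) * (g x - g y))
  have e : ∀ x y, F x y / √(c x y) * (√(c x y) * (g x - g y)) = F x y * (g x - g y) := by
    intro x y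
    by_cases h : F x y = 0
    · simp [h]
    · have : √(c x y) ≠ 0 := (Real.sqrt_pos.2 (realConductance_pos R (hadj x y h))).ne'
      field_simp
  simp only [e, mul_pow, div_pow, Real.sq_sqrt (hc.nonneg _ _), hpair] at hcs
  have hle : ∑ x ∈ T, ∑ y ∈ T, F x y ^ 2 / c x y ≤ E := by
    rw [← Finset.sum_product']
    refine (ENNReal.ofReal_le_iff_le_toReal hfin).1 ?_
    rw [ENNReal.ofReal_sum_of_nonneg fun p _ => div_nonneg (sq_nonneg _) (hc.nonneg _ _)]
    exact ENNReal.sum_le_tsum _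
  have hg0 : 0 ≤ energyOn c T g := Finset.sum_nonneg fun x _ => Finset.sum_nonneg fun y _ =>
    mul_nonneg (hc.nonneg x y) (sq_nonneg _)
  rw [div_le_iff₀ (by positivity)]
  have := mul_le_mul_of_nonneg_right (hle.trans (le_add_of_nonneg_right zero_le_one)) hg0
  calc (4 : ℝ) = 2 ^ 2 := by norm_num
    _ ≤ _ := hcs
    _ ≤ (E + 1) * energyOn c T g := this
    _ = _ := mul_comm _ _

/-- If the capacity of `v` is positive, the current generated by the limiting hitting
probabilities is a unit flow of finite energy. -/
lemma PosCapacity.exists_flow {R : Resistances G} {v : V}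
    (h : PosCapacity G (realConductance G R) v) :
    ∃ F, IsUnitFlow G v F ∧ energy G R F < ∞ := by
  classical
  set c := realConductance G R with hcdef
  have hc : IsConductance G c := isConductance_realConductance le_rfl R
  obtain ⟨δ, hδ, hn⟩ := (posCapacity_iff hc).1 h
  set u : V → ℝ := fun x => ⨆ n, hitWithin G c v n x
  have hu : ∀ x, Tendsto (fun n => hitWithin G c v n x) atTop (𝓝 (u x)) :=
    fun x => exists_tendsto_hitWithin hc x
  have hlap : ∀ x, Tendsto (fun n => laplacian G c (hitWithin G c v n) x) atTop
      (𝓝 (laplacian G c u x)) := fun x =>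
    tendsto_finsetSum _ fun y _ => ((hu x).sub (hu y)).const_mul _
  set L := laplacian G c u v with hL
  have hLpos : 0 < L := hδ.trans_le (ge_of_tendsto' (hlap v) hn)
  -- The energy bound passes to the limit on each finite set. The current generated by `u` has
  -- strength `L`, whence the normalisation by `L` below.
  have hEu : ∀ T, energyOn c T u ≤ 2 * L := fun T =>
    le_of_tendsto_of_tendsto' (tendsto_finsetSum _ fun x _ => tendsto_finsetSum _ fun y _ =>
      (((hu x).sub (hu y)).pow 2).const_mul _) ((hlap v).const_mul 2)
      fun n => energyOn_hitWithin_le hc n T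
  refine ⟨fun x y => c x y * (u x - u y) / L, ⟨fun x y => ?_, fun x y hxy => ?_, ?_, ?_⟩, ?_⟩
  · rw [hc.symm y x]; ring
  · have : c x y = 0 := by
      by_contra h
      exact hxy (hc.adj x y h)
    simp [this]
  · rw [← Finset.sum_div]
    exact div_self hLpos.ne'
  · intro x hx
    rw [← Finset.sum_div]
    have : laplacian G c u x = 0 :=
      tendsto_nhds_unique (hlap x) (tendsto_laplacian_hitWithin_of_ne hc hx)
    exact div_eq_zero_iff.2 (Or.inl this)
  · rw [energy_eq_tsum, ← hcdef]
    have hterm : ∀ x y, (c x y * (u x - u y) / L) ^ 2 / c x y =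
        c x y * (u x - u y) ^ 2 / L ^ 2 := fun x y => by
      by_cases h0 : c x y = 0
      · simp [h0]
      · field_simp
    simp only [hterm]
    have hb : (∑' p : V × V, ENNReal.ofReal (c p.1 p.2 * (u p.1 - u p.2) ^ 2 / L ^ 2)) ≤
        ENNReal.ofReal (2 * L / L ^ 2) := by
      rw [ENNReal.tsum_eq_iSup_sum]
      refine iSup_le fun A => ?_
      have hnn : ∀ p : V × V, 0 ≤ c p.1 p.2 * (u p.1 - u p.2) ^ 2 / L ^ 2 := fun p =>
        div_nonneg (mul_nonneg (hc.nonneg _ _) (sq_nonneg _)) (sq_nonneg _)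
      rw [← ENNReal.ofReal_sum_of_nonneg fun p _ => hnn p]
      refine ENNReal.ofReal_le_ofReal ?_
      set T := A.image Prod.fst ∪ A.image Prod.snd
      have hA : A ⊆ T ×ˢ T := fun p hp => Finset.mem_product.2
        ⟨Finset.mem_union_left _ (Finset.mem_image_of_mem _ hp),
          Finset.mem_union_right _ (Finset.mem_image_of_mem _ hp)⟩
      refine (Finset.sum_le_sum_of_subset_of_nonneg hA fun p _ _ => hnn p).trans ?_
      rw [← Finset.sum_div, Finset.sum_product]
      exact div_le_div_of_nonneg_right (hEu T) (sq_nonneg _)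
    exact ENNReal.div_lt_top (hb.trans_lt ENNReal.ofReal_lt_top).ne (by simp)

end Flow

/-! ### Measurability of the transience events; percolation clusters. -/

section Measurability

variable {V : Type*} {G : SimpleGraph V} [G.LocallyFinite] {Ω : Type*} [MeasurableSpace Ω]
  {c : Ω → V → V → ℝ}

lemma measurable_hitWithin (hm : ∀ x y, Measurable fun ω => c ω x y) (o : V) (n : ℕ) (x : V) :
    Measurable fun ω => hitWithin G (c ω) o n x := by
  classical
  induction n generalizing x with
  | zero => exact measurable_const
  | succ n ih =>
    by_cases h : x = o
    · simp only [h, hitWithin_self]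
      exact measurable_const
    · simp only [hitWithin_succ_of_ne n h, stepMean]
      have htot : Measurable fun ω => totalConductance G (c ω) x :=
        Finset.measurable_sum _ fun y _ => hm x y
      exact Measurable.ite (htot (measurableSet_singleton 0)) (ih x)
        ((Finset.measurable_sum _ fun y _ => (hm x y).mul (ih y)).div htot)

lemma measurable_laplacian_hitWithin (hm : ∀ x y, Measurable fun ω => c ω x y) (o : V) (n : ℕ)
    (x : V) : Measurable fun ω => laplacian G (c ω) (hitWithin G (c ω) o n) x :=
  Finset.measurable_sum _ fun y _ => (hm x y).mul
    ((measurable_hitWithin hm o n x).sub (measurable_hitWithin hm o n y))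

/-- The Laplacian criterion replaces the uncountable quantifier over test functions by countably
many conditions. -/
lemma measurableSet_posCapacity (hm : ∀ x y, Measurable fun ω => c ω x y)
    (hc : ∀ ω, IsConductance G (c ω)) (o : V) : MeasurableSet {ω | PosCapacity G (c ω) o} := by
  have : {ω | PosCapacity G (c ω) o} = ⋃ k : ℕ, ⋂ n : ℕ,
      {ω | 1 / ((k : ℝ) + 1) ≤ laplacian G (c ω) (hitWithin G (c ω) o n) o} := by
    ext ω
    simp only [Set.mem_ofPred_eq, Set.mem_iUnion, Set.mem_iInter, posCapacity_iff (hc ω)]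
    constructor
    · rintro ⟨δ, hδ, h⟩
      obtain ⟨k, hk⟩ := exists_nat_one_div_lt hδ
      exact ⟨k, fun n => hk.le.trans (h n)⟩
    · rintro ⟨k, h⟩
      exact ⟨_, Nat.one_div_pos_of_nat, h⟩
  rw [this]
  exact MeasurableSet.iUnion fun k => MeasurableSet.iInter fun n =>
    measurableSet_le measurable_const (measurable_laplacian_hitWithin hm o n o)

omit [G.LocallyFinite] in
lemma measurable_realConductance (x y : V) :
    Measurable fun R : Resistances G => realConductance G R x y := by
  by_cases h : G.Adj x y
  · simp only [realConductance, dif_pos h]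
    exact (measurable_subtype_coe.comp (measurable_pi_apply _)).inv
  · simp only [realConductance, dif_neg h]
    exact measurable_const

omit [G.LocallyFinite] in
lemma openSubgraph_le (ω : G.edgeSet → Bool) : openSubgraph G ω ≤ G := fun _ _ h => h.1

/-- The conductances of simple random walk on the open subgraph. -/
def openConductance (G : SimpleGraph V) (ω : G.edgeSet → Bool) : V → V → ℝ :=
  realConductance (openSubgraph G ω) (unitResistances _)

omit [G.LocallyFinite] in
open Classical in
lemma openConductance_apply (ω : G.edgeSet → Bool) (x y : V) :
    openConductance G ω x y =
      if h : G.Adj x y then (if ω ⟨s(x, y), h⟩ = true then 1 else 0) else 0 := by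
  unfold openConductance realConductance
  by_cases h : G.Adj x y
  · by_cases h' : ω ⟨s(x, y), h⟩ = true
    · have ho : (openSubgraph G ω).Adj x y := ⟨h, h'⟩
      rw [dif_pos ho, dif_pos h, if_pos h']
      simp [unitResistances]
    · have ho : ¬ (openSubgraph G ω).Adj x y := fun ⟨_, h''⟩ => h' h''
      rw [dif_neg ho, dif_pos h, if_neg h']
  · have ho : ¬ (openSubgraph G ω).Adj x y := fun ⟨h'', _⟩ => h h''
    rw [dif_neg ho, dif_neg h]

omit [G.LocallyFinite] in
lemma isConductance_openConductance (ω : G.edgeSet → Bool) :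
    IsConductance G (openConductance G ω) :=
  isConductance_realConductance (openSubgraph_le ω) _

omit [G.LocallyFinite] in
lemma measurable_openConductance (x y : V) :
    Measurable fun ω : G.edgeSet → Bool => openConductance G ω x y := by
  classical
  simp only [openConductance_apply]
  by_cases h : G.Adj x y
  · simp only [dif_pos h]
    exact (Measurable.of_discrete (f := fun b : Bool => if b = true then (1 : ℝ) else 0)).comp
      (measurable_pi_apply _)
  · simp only [dif_neg h]
    exact measurable_const

/-- Some cluster is transient iff some vertex has positive capacity in the open subgraph. -/
lemma exists_transientCluster_iff (ω : G.edgeSet → Bool) :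
    (∃ C : (openSubgraph G ω).ConnectedComponent, TransientCluster (openSubgraph G ω) C) ↔
      ∃ v, PosCapacity G (openConductance G ω) v := by
  constructor
  · rintro ⟨C, hC⟩
    obtain ⟨v, hv⟩ := C.nonempty_supp
    exact ⟨v, (transientFrom_iff (openSubgraph_le ω) _ v).1 (hC v hv)⟩
  · rintro ⟨v, hv⟩
    refine ⟨(openSubgraph G ω).connectedComponentMk v, fun w hw => ?_⟩
    refine (transientFrom_iff (openSubgraph_le ω) _ w).2 ?_
    exact hv.of_reachable (isConductance_openConductance ω)
      (fun x y h => realConductance_pos _ h) (SimpleGraph.ConnectedComponent.exact hw).symm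

end Measurability

/-! ### A zero-one law for product measures. -/

section ZeroOne

/-- Kolmogorov's zero-one law for events that are invariant under changes of finitely many
coordinates. -/
lemma infinitePi_zero_or_one {ι : Type*} {X : ι → Type*} [∀ i, MeasurableSpace (X i)]
    (P : ∀ i, Measure (X i)) [∀ i, IsProbabilityMeasure (P i)] {A : Set (∀ i, X i)}
    (hA : MeasurableSet A)
    (hinv : ∀ x y : ∀ i, X i, {i | x i ≠ y i}.Finite → x ∈ A → y ∈ A) :
    Measure.infinitePi P A = 0 ∨ Measure.infinitePi P A = 1 := by
  classical
  let m : ι → MeasurableSpace (∀ i, X i) := fun i => MeasurableSpace.comap (Function.eval i) inferInstance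
  have hindep : iIndep m (Measure.infinitePi P) :=
    iIndepFun_infinitePi (X := fun i (x : X i) => x) fun i => measurable_id
  refine measure_zero_or_one_of_measurableSet_limsup (s := m) (f := cofinite)
    (p := fun s : Set ι => s.Finite) (ns := fun s : Finset ι => (s : Set ι))
    (fun i => (measurable_pi_apply i).comap_le) hindep
    (fun s hs => hs.compl_mem_cofinite) (fun s t => ⟨s ∪ t, by simp, by simp⟩)
    (fun s => s.finite_toSet) (fun i => ⟨{i}, by simp⟩) ?_
  rw [hasBasis_cofinite.limsup_eq_iInf_iSup, MeasurableSpace.measurableSet_iInf]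
  intro s
  rw [MeasurableSpace.measurableSet_iInf]
  intro hs
  have hne : ∀ i, Nonempty (X i) := fun i => nonempty_of_isProbabilityMeasure (P i)
  let x₀ : ∀ i, X i := fun i => (hne i).some
  -- Resetting the coordinates in the finite set `s` to fixed values depends only on the others and
  -- preserves `A`, so `A` is measurable with respect to the coordinates outside `s`.
  let φ : (∀ i, X i) → ∀ i, X i := fun x i => if i ∈ s then x₀ i else x i
  have hφ : @Measurable _ _ (⨆ i ∈ sᶜ, m i) _ φ := by
    refine (@measurable_pi_iff _ _ _ (⨆ i ∈ sᶜ, m i) _ _).2 fun i => ?_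
    by_cases hi : i ∈ s
    · simp only [φ, if_pos hi]
      exact @measurable_const _ _ _ (⨆ i ∈ sᶜ, m i) _
    · simp only [φ, if_neg hi]
      exact (comap_measurable (Function.eval i)).mono
        (le_iSup₂ (f := fun i (_ : i ∈ sᶜ) => m i) i hi) le_rfl
  have hfin : ∀ x, {i | x i ≠ φ x i}.Finite := fun x => hs.subset fun i hi => by
    by_contra h
    exact hi (if_neg h).symm
  have hAφ : A = φ ⁻¹' A := by
    ext x
    exact ⟨hinv x (φ x) (hfin x), hinv (φ x) x (by simpa only [ne_comm] using hfin x)⟩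
  rw [hAφ]
  exact hφ hA

end ZeroOne

/-! ### Finite mean resistances, and transience inherited from percolation. -/

section Main

variable {V : Type*} {G : SimpleGraph V} [G.LocallyFinite]

lemma isTransient_of_posCapacity (hG : G.Connected) {R : Resistances G} {v : V}
    (h : PosCapacity G (realConductance G R) v) : IsTransient G R := fun w =>
  (transientFrom_iff le_rfl R w).2 (h.of_reachable (isConductance_realConductance le_rfl R)
    (fun _ _ hxy => realConductance_pos R hxy) (hG.preconnected v w))

omit [G.LocallyFinite] in
/-- A flow of finite energy for unit resistances has finite energy almost surely for i.i.d.
resistances of finite mean. -/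
lemma ae_energy_lt_top [Countable V] {μ : Measure (Set.Ioi (0 : ℝ))} [IsProbabilityMeasure μ]
    (hμ : Integrable (fun x : Set.Ioi (0 : ℝ) => (x : ℝ)) μ) {F : V → V → ℝ}
    (hF : energy G (unitResistances G) F < ∞) :
    ∀ᵐ R ∂iidResistances G μ, energy G R F < ∞ := by
  have hsum : (∑' d : G.Dart, ENNReal.ofReal (F d.fst d.snd ^ 2)) ≠ ∞ := fun h => by
    simp only [energy, unitResistances, mul_one] at hF
    rw [h, ENNReal.top_div_of_ne_top (by simp)] at hF
    exact lt_irrefl _ hF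
  have hcoord : ∀ e : G.edgeSet, Measurable fun R : Resistances G => ENNReal.ofReal (R e : ℝ) :=
    fun e => (measurable_subtype_coe.comp (measurable_pi_apply e)).ennreal_ofReal
  have hterm : ∀ (d : G.Dart) (R : Resistances G),
      ENNReal.ofReal (F d.fst d.snd ^ 2 * (R ⟨d.edge, d.edge_mem⟩ : ℝ)) =
        ENNReal.ofReal (F d.fst d.snd ^ 2) * ENNReal.ofReal (R ⟨d.edge, d.edge_mem⟩ : ℝ) :=
    fun d R => ENNReal.ofReal_mul (sq_nonneg _)
  have hmean : ∀ e : G.edgeSet, ∫⁻ R, ENNReal.ofReal (R e : ℝ) ∂iidResistances G μ =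
      ∫⁻ x, ENNReal.ofReal (x : ℝ) ∂μ := fun e =>
    (measurePreserving_eval_infinitePi (fun _ : G.edgeSet => μ) e).lintegral_comp
      (f := fun x : Set.Ioi (0 : ℝ) => ENNReal.ofReal (x : ℝ))
      measurable_subtype_coe.ennreal_ofReal
  have hfin : ∫⁻ x : Set.Ioi (0 : ℝ), ENNReal.ofReal (x : ℝ) ∂μ ≠ ∞ := hμ.lintegral_lt_top.ne
  have hcount : Countable G.Dart := (SimpleGraph.Dart.toProd_injective (G := G)).countable
  -- By Tonelli, the expected sum is the sum for unit resistances times the mean of `μ`.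
  have hint : ∫⁻ R, (∑' d : G.Dart,
      ENNReal.ofReal (F d.fst d.snd ^ 2 * (R ⟨d.edge, d.edge_mem⟩ : ℝ))) ∂iidResistances G μ ≠ ∞ := by
    simp only [hterm]
    rw [lintegral_tsum fun d => ((hcoord _).const_mul _).aemeasurable]
    simp only [lintegral_const_mul _ (hcoord _), hmean, ENNReal.tsum_mul_right]
    exact ENNReal.mul_ne_top hsum hfin
  have hmeas : Measurable fun R : Resistances G => ∑' d : G.Dart,
      ENNReal.ofReal (F d.fst d.snd ^ 2 * (R ⟨d.edge, d.edge_mem⟩ : ℝ)) := by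
    simp only [hterm]
    exact Measurable.tsum fun d => (hcoord _).const_mul _
  filter_upwards [ae_lt_top hmeas hint] with R hR
  exact ENNReal.div_lt_top hR.ne (by simp)

theorem ae_effectiveResistance_lt_top_and_isTransient (hG : G.Connected)
    (μ : Measure (Set.Ioi (0 : ℝ))) [IsProbabilityMeasure μ]
    (hμ : Integrable (fun x : Set.Ioi (0 : ℝ) => (x : ℝ)) μ)
    (h : IsTransient G (unitResistances G)) :
    ∀ᵐ R ∂iidResistances G μ, (∀ v, effectiveResistance G R v < ∞) ∧ IsTransient G R := by
  have := countable_of_connected hG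
  choose F hF hE using fun v => ((transientFrom_iff le_rfl _ v).1 (h v)).exists_flow
  filter_upwards [ae_all_iff.2 fun v => ae_energy_lt_top hμ (hE v)] with R hR
  exact ⟨fun v => (iInf₂_le (F v) (hF v)).trans_lt (hR v),
    fun v => (transientFrom_iff le_rfl R v).2 ((hF v).posCapacity (hR v))⟩

/-- The ratio of new to old resistances is bounded: it is 1 off a finite set, and on that set at
most the sum of the ratios. So the capacity changes by a bounded factor at worst. -/
lemma PosCapacity.of_finite_change {R R' : Resistances G} (h : {e | R e ≠ R' e}.Finite) {v : V}
    (hv : PosCapacity G (realConductance G R) v) : PosCapacity G (realConductance G R') v := by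
  set B : ℝ := 1 + ∑ e ∈ h.toFinset, (R' e : ℝ) / (R e : ℝ) with hB
  have hnn : ∀ e, 0 ≤ (R' e : ℝ) / (R e : ℝ) := fun e =>
    (div_pos (Set.mem_Ioi.1 (R' e).2) (Set.mem_Ioi.1 (R e).2)).le
  have hs := Finset.sum_nonneg (s := h.toFinset) fun e _ => hnn e
  have hB0 : 0 < B := by linarith
  have hle : ∀ e, (R' e : ℝ) ≤ B * R e := fun e => by
    have he : (0 : ℝ) < R e := (R e).2
    rw [← div_le_iff₀ he]
    by_cases hd : R e = R' e
    · rw [hd, div_self (hd ▸ he).ne']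
      linarith
    · have := Finset.single_le_sum (f := fun e => (R' e : ℝ) / (R e : ℝ)) (fun e _ => hnn e)
        (h.mem_toFinset.2 hd)
      linarith
  refine hv.of_le (inv_pos.2 hB0) fun x y => ?_
  unfold realConductance
  split_ifs with hxy
  · rw [← mul_inv]
    exact inv_anti₀ (R' _).2 (hle _)
  · simp

lemma measurableSet_exists_posCapacity_realConductance [Countable V] :
    MeasurableSet {R : Resistances G | ∃ v, PosCapacity G (realConductance G R) v} := by
  rw [show {R : Resistances G | ∃ v, PosCapacity G (realConductance G R) v} =
    ⋃ v, {R | PosCapacity G (realConductance G R) v} by ext; simp]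
  exact MeasurableSet.iUnion fun v => measurableSet_posCapacity measurable_realConductance
    (fun R => isConductance_realConductance le_rfl R) v

lemma measurableSet_exists_posCapacity_openConductance [Countable V] :
    MeasurableSet {ω : G.edgeSet → Bool | ∃ v, PosCapacity G (openConductance G ω) v} := by
  rw [show {ω : G.edgeSet → Bool | ∃ v, PosCapacity G (openConductance G ω) v} =
    ⋃ v, {ω | PosCapacity G (openConductance G ω) v} by ext; simp]
  exact MeasurableSet.iUnion fun v => measurableSet_posCapacity measurable_openConductance
    isConductance_openConductance v

lemma eq_bernoulliMeasure {m : Measure Bool} [IsProbabilityMeasure m] {p : unitInterval}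
    (h : m {true} = ENNReal.ofReal p) : m = bernoulliMeasure true false p := by
  have hb : bernoulliMeasure true false p {true} = ENNReal.ofReal p := by
    rw [bernoulliMeasure_apply_of_mem_of_notMem p (by measurability) (by simp) (by simp),
      ← ENNReal.ofReal_coe_nnreal]
    rfl
  have hc : ({false} : Set Bool) = {true}ᶜ := by ext b; cases b <;> simp
  refine Measure.ext_of_singleton fun b => ?_
  cases b
  · rw [hc, prob_compl_eq_one_sub (by measurability), prob_compl_eq_one_sub (by measurability),
      h, hb]
  · rw [h, hb]

omit [G.LocallyFinite] in
lemma infinitePi_map_bondPercolation {X : Type*} [MeasurableSpace X] (ν : Measure X)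
    [IsProbabilityMeasure ν] {f : X → Bool} (hf : Measurable f) {p : unitInterval}
    (h : ν (f ⁻¹' {true}) = ENNReal.ofReal p) :
    (Measure.infinitePi fun _ : G.edgeSet => ν).map (fun z e => f (z e)) = bondPercolation G p := by
  have := Measure.isProbabilityMeasure_map (μ := ν) hf.aemeasurable
  rw [Measure.infinitePi_map_pi _ fun _ => hf, bondPercolation,
    eq_bernoulliMeasure (m := ν.map f) (p := p) (by rw [Measure.map_apply hf (by measurability), h])]

theorem ae_isTransient_of_percolation (hG : G.Connected) {p : unitInterval} (hp : p < 1)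
    (h : 0 < bondPercolation G p {ω | ∃ v, PosCapacity G (openConductance G ω) v})
    (μ : Measure (Set.Ioi (0 : ℝ))) [IsProbabilityMeasure μ] :
    ∀ᵐ R ∂iidResistances G μ, IsTransient G R := by
  have := countable_of_connected hG
  obtain ⟨M, hM0, hM⟩ : ∃ M : ℝ, 0 < M ∧
      ENNReal.ofReal p < μ {x : Set.Ioi (0 : ℝ) | (x : ℝ) ≤ M} := by
    have hmono : Monotone fun n : ℕ => {x : Set.Ioi (0 : ℝ) | (x : ℝ) ≤ (n : ℝ) + 1} :=
      fun m n hmn x (hx : (x : ℝ) ≤ (m : ℝ) + 1) => hx.trans (by gcongr)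
    have huniv : ⋃ n : ℕ, {x : Set.Ioi (0 : ℝ) | (x : ℝ) ≤ (n : ℝ) + 1} = Set.univ := by
      refine Set.eq_univ_of_forall fun x => Set.mem_iUnion.2 ?_
      obtain ⟨n, hn⟩ := exists_nat_ge (x : ℝ)
      exact ⟨n, by simp only [Set.mem_ofPred_eq]; linarith⟩
    have hlim := tendsto_measure_iUnion_atTop (μ := μ) hmono
    rw [huniv, measure_univ] at hlim
    have hp1 : ENNReal.ofReal p < 1 := by
      rw [← ENNReal.ofReal_one]
      exact (ENNReal.ofReal_lt_ofReal_iff one_pos).2 hp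
    obtain ⟨n, hn⟩ := (hlim.eventually_const_lt hp1).exists
    exact ⟨(n : ℝ) + 1, by positivity, hn⟩
  set q := μ {x : Set.Ioi (0 : ℝ) | (x : ℝ) ≤ M} with hq
  have hqtop : q ≠ ∞ := measure_ne_top _ _
  have hq0 : 0 < q.toReal := ENNReal.toReal_pos (zero_le.trans_lt hM).ne' hqtop
  have hpq : (p : ℝ) ≤ q.toReal := (ENNReal.ofReal_le_iff_le_toReal hqtop).1 hM.le
  -- Retention probability for edges of resistance at most `M`: such an edge has probability `q`, so
  -- it is open with probability q · (p / q) = p.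
  let r : unitInterval := ⟨p / q.toReal, div_nonneg p.2.1 hq0.le, div_le_one_of_le₀ hpq hq0.le⟩
  let ν : Measure (Set.Ioi (0 : ℝ) × Bool) := μ.prod (bernoulliMeasure true false r)
  have hset : MeasurableSet {x : Set.Ioi (0 : ℝ) | (x : ℝ) ≤ M} :=
    measurableSet_le measurable_subtype_coe measurable_const
  let f : Set.Ioi (0 : ℝ) × Bool → Bool := fun z => decide ((z.1 : ℝ) ≤ M) && z.2
  have hfpre : f ⁻¹' {true} = {x : Set.Ioi (0 : ℝ) | (x : ℝ) ≤ M} ×ˢ {true} := by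
    ext z
    simp [f]
  have hf : Measurable f := by
    refine measurable_to_bool ?_
    rw [hfpre]
    exact hset.prod (measurableSet_singleton _)
  have hmapf : (Measure.infinitePi fun _ : G.edgeSet => ν).map (fun z e => f (z e)) =
      bondPercolation G p := by
    refine infinitePi_map_bondPercolation ν hf ?_
    rw [hfpre, Measure.prod_prod, ← hq,
      bernoulliMeasure_apply_of_mem_of_notMem r (by measurability) (by simp) (by simp),
      ← ENNReal.ofReal_toReal hqtop, ← ENNReal.ofReal_coe_nnreal,
      ← ENNReal.ofReal_mul ENNReal.toReal_nonneg]
    congr 1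
    exact mul_div_cancel₀ _ hq0.ne'
  have hmapR : (Measure.infinitePi fun _ : G.edgeSet => ν).map (fun z e => (z e).1) =
      iidResistances G μ := by
    rw [Measure.infinitePi_map_pi (fun _ : G.edgeSet => ν) (f := fun _ => Prod.fst)
      fun _ => measurable_fst]
    simp [ν, iidResistances]
  have hA := measurableSet_exists_posCapacity_realConductance (G := G)
  have hpos : iidResistances G μ {R | ∃ v, PosCapacity G (realConductance G R) v} ≠ 0 := by
    rw [← hmapf, Measure.map_apply (by fun_prop)
      measurableSet_exists_posCapacity_openConductance] at h
    rw [← hmapR, Measure.map_apply (by fun_prop) hA]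
    refine (h.trans_le (measure_mono ?_)).ne'
    rintro z ⟨v, hv⟩
    refine ⟨v, hv.of_le (inv_pos.2 hM0) fun x y => ?_⟩
    rw [openConductance_apply]
    unfold realConductance
    split_ifs with hxy ho
    · rw [mul_one]
      refine inv_anti₀ (z _).1.2 ?_
      simp only [f, Bool.and_eq_true, decide_eq_true_eq] at ho
      exact ho.1
    · rw [mul_zero]
      exact (inv_pos.2 (z _).1.2).le
    · simp
  -- The event that some vertex has positive capacity survives finite changes of the resistances, so
  -- positive probability means probability 1.
  have hone := (infinitePi_zero_or_one (fun _ : G.edgeSet => μ) hA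
    fun R R' hRR' ⟨v, hv⟩ => ⟨v, hv.of_finite_change hRR'⟩).resolve_left hpos
  have hprob : IsProbabilityMeasure (iidResistances G μ) := by unfold iidResistances; infer_instance
  have hae : ∀ᵐ R ∂iidResistances G μ, R ∈ {R | ∃ v, PosCapacity G (realConductance G R) v} :=
    (prob_compl_eq_zero_iff hA).2 hone
  filter_upwards [hae] with R ⟨v, hv⟩
  exact isTransient_of_posCapacity hG hv

end Main

/-! ### Heavy-tailed resistances when all percolation clusters are recurrent. -/

section Recurrent

variable {V : Type*} {G : SimpleGraph V} [G.LocallyFinite]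

/-- Open the edges whose label is less than `k`. -/
def openBelow (z : G.edgeSet → ℕ) (k : ℕ) : G.edgeSet → Bool := fun e => decide (z e < k)

omit [G.LocallyFinite] in
lemma measurable_openBelow (k : ℕ) : Measurable fun z : G.edgeSet → ℕ => openBelow z k :=
  measurable_pi_iff.2 fun e => (Measurable.of_discrete (f := fun n : ℕ => decide (n < k))).comp
    (measurable_pi_apply e)

lemma ae_openBelow_not_posCapacity [Countable V] {ν : Measure ℕ} [IsProbabilityMeasure ν]
    (hν : ∀ n, ν {n} ≠ 0)
    (h : ∀ p : unitInterval, p < 1 →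
      bondPercolation G p {ω | ∃ v, PosCapacity G (openConductance G ω) v} = 0) (k : ℕ) :
    ∀ᵐ z ∂Measure.infinitePi fun _ : G.edgeSet => ν,
      ∀ v, ¬ PosCapacity G (openConductance G (openBelow z k)) v := by
  let p : unitInterval := ⟨ν.real {n | n < k}, measureReal_nonneg, measureReal_le_one⟩
  -- The label `k` has positive probability, so labels below `k` do not exhaust the mass.
  have hp : p < 1 := by
    have hlt : ν {n | n < k} < 1 := by
      refine (measure_mono (fun n (hn : n < k) => ?_ : {n | n < k} ⊆ {k}ᶜ)).trans_lt ?_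
      · exact hn.ne
      · rw [prob_compl_eq_one_sub (measurableSet_singleton k)]
        exact ENNReal.sub_lt_self ENNReal.one_ne_top one_ne_zero (hν k)
    change ν.real {n | n < k} < 1
    rw [measureReal_def, ← ENNReal.toReal_one]
    exact (ENNReal.toReal_lt_toReal (measure_ne_top _ _) ENNReal.one_ne_top).2 hlt
  have hmap := infinitePi_map_bondPercolation (G := G) ν
    (f := fun n : ℕ => decide (n < k)) .of_discrete (p := p) (by
      rw [show (fun n : ℕ => decide (n < k)) ⁻¹' {true} = {n | n < k} by ext; simp]
      exact (ENNReal.ofReal_toReal (measure_ne_top _ _)).symm)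
  change Measure.map (fun z => openBelow z k) _ = _ at hmap
  have h0 := h p hp
  rw [← hmap, Measure.map_apply (measurable_openBelow k)
    measurableSet_exists_posCapacity_openConductance] at h0
  filter_upwards [measure_eq_zero_iff_ae_notMem.1 h0] with z hz v hv
  exact hz ⟨v, hv⟩

/-- On a recurrent random subgraph the hitting probabilities of `o` have small energy with
probability as close to `1` as desired. -/
lemma exists_measure_laplacian_gt_le {Ω : Type*} [MeasurableSpace Ω] {P : Measure Ω}
    [IsFiniteMeasure P] {c : Ω → V → V → ℝ} (hm : ∀ x y, Measurable fun ω => c ω x y)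
    (hc : ∀ ω, IsConductance G (c ω)) {o : V} (h : ∀ᵐ ω ∂P, ¬ PosCapacity G (c ω) o)
    {δ : ℝ} (hδ : 0 < δ) {ε : ℝ≥0∞} (hε : 0 < ε) :
    ∃ n, P {ω | δ < laplacian G (c ω) (hitWithin G (c ω) o n) o} ≤ ε := by
  have hanti : Antitone fun n => {ω | δ < laplacian G (c ω) (hitWithin G (c ω) o n) o} :=
    fun m n hmn ω hω => lt_of_lt_of_le hω (laplacian_hitWithin_self_antitone (hc ω) hmn)
  have hlim := tendsto_measure_iInter_atTop (μ := P) (fun n => (measurableSet_lt measurable_const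
    (measurable_laplacian_hitWithin hm o n o)).nullMeasurableSet) hanti ⟨0, measure_ne_top _ _⟩
  have hnull : P (⋂ n, {ω | δ < laplacian G (c ω) (hitWithin G (c ω) o n) o}) = 0 := by
    refine measure_eq_zero_iff_ae_notMem.2 ?_
    filter_upwards [h] with ω hω hmem
    exact hω ((posCapacity_iff (hc ω)).2 ⟨δ, hδ, fun n => (Set.mem_iInter.1 hmem n).le⟩)
  rw [hnull] at hlim
  obtain ⟨n, hn⟩ := (hlim.eventually_lt_const hε).exists
  exact ⟨n, hn.le⟩

/-- Adding conductances of size at most `η` to a network changes the energy of the hitting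
probabilities by little. -/
lemma energyOn_hitWithin_le_add {c c' : V → V → ℝ} (hc : IsConductance G c) {o : V} {η : ℝ}
    (hη : 0 ≤ η) (hle : ∀ x y, c' x y ≤ c x y + η) (n : ℕ) (T : Finset V) :
    energyOn c' T (hitWithin G c o n) ≤
      2 * laplacian G c (hitWithin G c o n) o + (T.card : ℝ) ^ 2 * η := by
  refine le_trans ?_ (add_le_add_left (energyOn_hitWithin_le hc n T) _)
  have hsum : ∑ _x ∈ T, ∑ _y ∈ T, η = (T.card : ℝ) ^ 2 * η := by
    simp only [Finset.sum_const, nsmul_eq_mul]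
    ring
  rw [← hsum, energyOn, energyOn, ← Finset.sum_add_distrib]
  refine Finset.sum_le_sum fun x _ => ?_
  rw [← Finset.sum_add_distrib]
  refine Finset.sum_le_sum fun y _ => ?_
  have h1 : (hitWithin G c o n x - hitWithin G c o n y) ^ 2 ≤ 1 := by
    rw [sq_le_one_iff_abs_le_one, abs_le]
    constructor <;> linarith [hitWithin_nonneg (o := o) hc n x, hitWithin_nonneg (o := o) hc n y,
      hitWithin_le_one (o := o) hc n x, hitWithin_le_one (o := o) hc n y]
  have h2 := mul_le_mul_of_nonneg_right (hle x y)
    (sq_nonneg (hitWithin G c o n x - hitWithin G c o n y))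
  have h3 := mul_le_mul_of_nonneg_left h1 hη
  rw [add_mul] at h2
  linarith

/-- If percolation clusters are recurrent for every `p < 1`, then i.i.d. resistances with a
sufficiently heavy tail give a network that is not almost surely transient. -/
theorem exists_not_ae_isTransient (hG : G.Connected)
    (h : ∀ p : unitInterval, p < 1 →
      bondPercolation G p {ω | ∃ v, PosCapacity G (openConductance G ω) v} = 0) :
    ∃ μ : Measure (Set.Ioi (0 : ℝ)), IsProbabilityMeasure μ ∧
      ¬ ∀ᵐ R ∂iidResistances G μ, IsTransient G R := by
  have := countable_of_connected hG
  obtain ⟨o⟩ := hG.nonempty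
  -- All that is used of this law is that it charges every integer.
  let ν : Measure ℕ := poissonMeasure 1
  have hν : ∀ n, ν {n} ≠ 0 := fun n h0 => by
    have hpos := poissonMeasure_real_singleton_pos (r := 1) n one_pos
    rw [measureReal_def, h0, ENNReal.toReal_zero] at hpos
    exact lt_irrefl _ hpos
  let P := Measure.infinitePi fun _ : G.edgeSet => ν
  let c : ℕ → (G.edgeSet → ℕ) → V → V → ℝ := fun k z => openConductance G (openBelow z k)
  have hcm : ∀ k x y, Measurable fun z => c k z x y := fun k x y =>
    (measurable_openConductance x y).comp (measurable_openBelow k)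
  have hc : ∀ k z, IsConductance G (c k z) := fun k z => isConductance_openConductance _
  -- `N k` depends only on the law of the labels; the resistance values are chosen afterwards, so
  -- there is no circularity.
  choose N hN using fun k : ℕ => exists_measure_laplacian_gt_le (P := P) (hcm k) (hc k) (o := o)
    ((ae_openBelow_not_posCapacity hν h k).mono fun z hz => hz o)
    (δ := (1 / 2) ^ k) (by positivity) (ε := 2⁻¹ ^ k) (ENNReal.pow_pos (by simp) k)
  let T : ℕ → Finset V := fun k => closedNbhd G (ballFinset G o (N k))
  -- The summand 1 keeps conductances at most 1, partial sums make `b` monotone, and the last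
  -- summand makes the |T k|² pairs inside `T k` cost at most 2⁻ᵏ.
  let b : ℕ → ℝ := fun k => 1 + ∑ j ∈ Finset.range (k + 1), 2 ^ j * ((T j).card : ℝ) ^ 2
  have hterm : ∀ j, 0 ≤ (2 : ℝ) ^ j * ((T j).card : ℝ) ^ 2 := fun j => by positivity
  have hb1 : ∀ k, 1 ≤ b k := fun k =>
    le_add_of_nonneg_right (Finset.sum_nonneg fun j _ => hterm j)
  have hb0 : ∀ k, 0 < b k := fun k => one_pos.trans_le (hb1 k)
  have hbmono : Monotone b := fun m n hmn => add_le_add_right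
    (Finset.sum_le_sum_of_subset_of_nonneg (Finset.range_mono (by omega)) fun j _ _ => hterm j) 1
  have hbT : ∀ k, 2 ^ k * ((T k).card : ℝ) ^ 2 ≤ b k := fun k =>
    (Finset.single_le_sum (f := fun j => (2 : ℝ) ^ j * ((T j).card : ℝ) ^ 2)
      (fun j _ => hterm j) (Finset.self_mem_range_succ k)).trans (le_add_of_nonneg_left zero_le_one)
  let β : ℕ → Set.Ioi (0 : ℝ) := fun k => ⟨b k, hb0 k⟩
  have hβ : Measurable β := .of_discrete
  have hprob := Measure.isProbabilityMeasure_map (μ := ν) hβ.aemeasurable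
  refine ⟨ν.map β, hprob, fun hae => ?_⟩
  have hmap : P.map (fun z e => β (z e)) = iidResistances G (ν.map β) :=
    Measure.infinitePi_map_pi _ fun _ => hβ
  rw [← hmap] at hae
  have hmeas : Measurable fun (z : G.edgeSet → ℕ) e => β (z e) :=
    measurable_pi_iff.2 fun e => hβ.comp (measurable_pi_apply e)
  have hae1 := ae_of_ae_map hmeas.aemeasurable hae
  -- Borel–Cantelli, the exceptional probabilities being at most 2⁻ᵏ.
  have hae2 : ∀ᵐ z ∂P, ∀ᶠ k in atTop,
      z ∉ {z | (1 / 2) ^ k < laplacian G (c k z) (hitWithin G (c k z) o (N k)) o} := by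
    refine ae_eventually_notMem (ne_top_of_le_ne_top ?_ (ENNReal.tsum_le_tsum hN))
    rw [ENNReal.tsum_geometric]
    simp
  obtain ⟨z, hz1, hz2⟩ := (hae1.and hae2).exists
  obtain ⟨κ, hκ, hcap⟩ := (transientFrom_iff le_rfl _ o).1 (hz1 o)
  -- An edge with label below `k` is open, with conductance 1, in the comparison network; any other
  -- has resistance at least `b k`.
  have hle : ∀ k x y, realConductance G (fun e => β (z e)) x y ≤ c k z x y + (b k)⁻¹ := by
    intro k x y
    simp only [c, openConductance_apply, realConductance, openBelow, decide_eq_true_eq]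
    split_ifs with hxy hk
    · exact (inv_le_one_of_one_le₀ (hb1 _)).trans (le_add_of_nonneg_right (inv_pos.2 (hb0 k)).le)
    · rw [zero_add]
      exact inv_anti₀ (hb0 k) (hbmono (not_lt.1 hk))
    · exact add_nonneg le_rfl (inv_pos.2 (hb0 k)).le
  -- The test function has energy at most 2 · 2⁻ᵏ from the open edges plus 2⁻ᵏ from the added
  -- conductances, which finally falls below `κ`.
  have hlim : Tendsto (fun k : ℕ => 3 * (1 / 2 : ℝ) ^ k) atTop (𝓝 0) := by
    simpa using (tendsto_pow_atTop_nhds_zero_of_lt_one (r := (1 / 2 : ℝ)) (by norm_num)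
      (by norm_num)).const_mul 3
  obtain ⟨k, hk, hkκ⟩ := (hz2.and (hlim.eventually_lt_const hκ)).exists
  have hk' : laplacian G (c k z) (hitWithin G (c k z) o (N k)) o ≤ (1 / 2) ^ k := not_lt.1 hk
  have h1 := hcap (ballFinset G o (N k)) (hitWithin G (c k z) o (N k))
    (hitWithin_eq_zero (N k)) (hitWithin_self (N k))
  have h2 := energyOn_hitWithin_le_add (hc k z) (o := o) (inv_pos.2 (hb0 k)).le (hle k) (N k) (T k)
  have h3 : ((T k).card : ℝ) ^ 2 * (b k)⁻¹ ≤ (1 / 2) ^ k := by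
    rw [← div_eq_mul_inv, div_le_iff₀ (hb0 k), one_div, inv_pow, inv_mul_eq_div,
      le_div_iff₀ (by positivity), mul_comm]
    exact hbT k
  have h4 : κ ≤ _ := h1.trans h2
  linarith

end Recurrent

end RandomNetwork

end

theorem mainTheorem1 {V : Type*} (G : SimpleGraph V) [G.LocallyFinite] (hG : G.Connected) :
    (∀ μ : Measure (Set.Ioi (0 : ℝ)), IsProbabilityMeasure μ →
      Integrable (fun x : Set.Ioi (0 : ℝ) => (x : ℝ)) μ →
      RandomNetwork.IsTransient G (RandomNetwork.unitResistances G) →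
      ∀ᵐ R ∂(RandomNetwork.iidResistances G μ),
        (∀ v, RandomNetwork.effectiveResistance G R v < ∞) ∧ RandomNetwork.IsTransient G R) ∧
    ((∀ μ : Measure (Set.Ioi (0 : ℝ)), IsProbabilityMeasure μ →
        ∀ᵐ R ∂(RandomNetwork.iidResistances G μ), RandomNetwork.IsTransient G R) ↔
      ∃ p : unitInterval, p < 1 ∧
        0 < RandomNetwork.bondPercolation G p
          {ω | ∃ C : (RandomNetwork.openSubgraph G ω).ConnectedComponent,
            RandomNetwork.TransientCluster (RandomNetwork.openSubgraph G ω) C}) := by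
  simp only [RandomNetwork.exists_transientCluster_iff]
  refine ⟨fun μ _ hμ h => RandomNetwork.ae_effectiveResistance_lt_top_and_isTransient hG μ hμ h,
    fun h => ?_, fun ⟨p, hp, h⟩ μ _ => RandomNetwork.ae_isTransient_of_percolation hG hp h μ⟩
  by_contra! hcon
  obtain ⟨μ, hμ, hnot⟩ := RandomNetwork.exists_not_ae_isTransient hG
    fun p hp => nonpos_iff_eq_zero.1 (hcon p hp)
  exact hnot (h μ hμ)
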